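/- Let $L$ be a countable language with only function and constant symbols, and let $\mathbf V$ be a variety of $L$-algebras (the class of all $L$-structures satisfying a given set of identities). Let $\mathcal F_{\mathbf V}$ be the class of free algebras of $\mathbf V$ and $\mathcal F^\infty_{\mathbf V}$ the class of those with an infinite free generating set; let $*$ be the free product (coproduct) in $\mathbf V$. For $A,B\in\mathcal F_{\mathbf V}$ with $A\le B$ write $A\le^{\mathrm{ff}}_* B$ if $B=A*C$ for some subalgebra $C\in\mathcal F_{\mathbf V}$ of $B$. For a subset $S$ of a structure $M$ let $\mathrm{dcl}^{\mathrm{qf}}_M(S)$ be the quantifier-free definable closure of $S$ in $M$: the least set $T$ with $S\subseteq T\subseteq M$ that contains every $d\in M$ which is the unique solution in $M$ of a quantifier-free formula with parameters in $T$. Call $A\le B$ with sequences $(a_i)_{i<\omega}$ in $A$, $(b_i)_{i<\omega}$ in $B$ an *RCP pair* if * (a) $A$ is freely generated in $\mathbf V$ by $\{a_i:i<\omega\}$ and $\langle a_j:j\le i\rangle\le^{\mathrm{ff}}_* B$ for every $i<\omega$; * (b) $A\not\le^{\mathrm{ff}}_* B*C$ for every $C\in\mathcal F_{\mathbf V}$;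 * (c) $B$ is freely generated in $\mathbf V$ by $\{b_i:i<\omega\}$ and $\mathrm{dcl}^{\mathrm{qf}}_B(Ab_0)=B$. $\mathbf V$ satisfies the *Reinforced Construction Principle* (RCP) if an RCP pair exists. An *AEC-covering* of $(\mathcal F_{\mathbf V},\le^{\mathrm{ff}}_*)$ is an abstract elementary class $(\mathcal K,\preccurlyeq)$ of $L$-structures with amalgamation and joint embedding such that $\mathcal F^\infty_{\mathbf V}\subseteq\mathcal K$, and $A\le^{\mathrm{ff}}_* B$ implies $A\preccurlyeq B$ for $A,B\in\mathcal F_{\mathbf V}\cap\mathcal K$. A *monster model at* $\kappa$ is an $M\in\mathcal K$ such that every member of $\mathcal K$ of size $\le\kappa$ embeds strongly into $M$ (that is, with image $\preccurlyeq M$) and every isomorphism between two strong submodels of $M$ of size $<\kappa$ extends to an automorphism of $M$. The covering is *strong enough* if * (i) for all $A,B,C\in\mathcal F^\infty_{\mathbf V}$, if $A\preccurlyeq B$ then $A*C\preccurlyeq B*C$, where $A*C$ is read as the subalgebra of $B*C$ generated by $A$ and $C$; * (ii) for every RCP pair $A\le B$ and every $M\in\mathcal K$ with $B\preccurlyeq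 M$, $\mathrm{dcl}^{\mathrm{qf}}_B(Ab_0)=\mathrm{dcl}^{\mathrm{qf}}_M(Ab_0)$; * (iii) for all sufficiently large $\kappa$, every monster model $\mathfrak M$ at $\kappa$, every RCP pair $A\le B$ with $B\preccurlyeq\mathfrak M$ and every automorphism $f$ of $\mathfrak M$ fixing $A$ pointwise, $\mathrm{dcl}^{\mathrm{qf}}_{\mathfrak M}(Ab_0)=\mathrm{dcl}^{\mathrm{qf}}_{\mathfrak M}(Af(b_0))$. **Theorem.** Let $\mathbf V$ be a variety of algebras in a countable language which satisfies RCP, and let $(\mathcal K,\preccurlyeq)$ be a strong enough AEC-covering of $(\mathcal F_{\mathbf V},\le^{\mathrm{ff}}_*)$. Then $(\mathcal K,\preccurlyeq)$ is not superstable, i.e. there is no tail of cardinals on which it is $\lambda$-stable: for every cardinal $\mu$ there is $\lambda\ge\mu$ and a model $A\in\mathcal K$ of size $\lambda$ over which there are more than $\lambda$ Galois types of elements, where Galois types over $A$ are classes of elements of strong extensions of $A$, two elements being identified when their extensions can be strongly amalgamated over $A$ so that the elements coincide. The same holds with types computed in monster models: for every $\mu$ there is $\lambda\ge\mu$ such that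 in every monster model $\mathfrak M$ at any $\kappa>\lambda$ there is $A\preccurlyeq\mathfrak M$ of size $\lambda$ for which the automorphisms of $\mathfrak M$ fixing $A$ pointwise have more than $\lambda$ orbits on $\mathfrak M$. -/

import Mathlib

open FirstOrder Cardinal

universe u

/-! ### Varieties of algebras, free algebras, free products -/

/-- A variety of `L`-algebras, presented by a set of identities `s ≈ t` between `L`-terms in
variables indexed by `ℕ`. -/
abbrev AlgVariety (L : FirstOrder.Language.{0, 0}) : Type :=
  Set (L.Term ℕ × L.Term ℕ)

namespace AlgVariety

variable {L : FirstOrder.Language.{0, 0}} (V : AlgVariety L)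

/-- `M` is an algebra of the variety `V`, i.e. it satisfies all the identities of `V`. -/
def Mem (M : Type u) [L.Structure M] : Prop :=
  ∀ e ∈ V, ∀ v : ℕ → M, e.1.realize v = e.2.realize v

/-- The algebra `M ∈ V` is freely generated in `V` by the (injectively indexed) family `x`. -/
structure FreelyGenerates {M : Type u} [L.Structure M] {ι : Type*} (x : ι → M) : Prop where
  mem : V.Mem M
  injective : Function.Injective x
  lift : ∀ (D : Type u) [L.Structure D], V.Mem D → ∀ v : ι → D,
    ∃! h : M →[L] D, ∀ i, h (x i) = v i

/-- `M` belongs to `𝓕_V`: it is a free algebra of `V`, of any rank. -/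
def IsFree (M : Type u) [L.Structure M] : Prop :=
  ∃ (ι : Type u) (x : ι → M), V.FreelyGenerates x

/-- `M` belongs to `𝓕^∞_V`: it is a free algebra of `V` of infinite rank. -/
def IsFreeInf (M : Type u) [L.Structure M] : Prop :=
  ∃ (ι : Type u) (x : ι → M), Infinite ι ∧ V.FreelyGenerates x

/-- `P = A ∗ C`: the algebra `P ∈ V` is the free product in `V` (the coproduct in the category of
algebras of `V`) of its subalgebras `A` and `C`. -/
def IsFreeProduct {P : Type u} [L.Structure P] (A C : L.Substructure P) : Prop :=
  V.Mem P ∧ ∀ (D : Type u) [L.Structure D], V.Mem D → ∀ (f : A →[L] D) (g : C →[L] D),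
    ∃! h : P →[L] D, (∀ a : A, h a = f a) ∧ (∀ c : C, h c = g c)

/-- `A ≤∗^ff B`: `A` and `B` are free in `V`, and `B = A ∗ C` for some free `C`. -/
def FreeFactor {B : Type u} [L.Structure B] (A : L.Substructure B) : Prop :=
  V.IsFree A ∧ V.IsFree B ∧ ∃ C : L.Substructure B, V.IsFree C ∧ V.IsFreeProduct A C

end AlgVariety

/-! ### Quantifier-free definable closure -/

/-- `d` is the unique element of `M` that satisfies some quantifier-free formula with parameters
from `S`. -/
def QFDefinableOver (L : FirstOrder.Language.{0, 0}) {M : Type u} [L.Structure M]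
    (S : Set M) (d : M) : Prop :=
  ∃ φ : L.Formula (S ⊕ Unit), φ.IsQF ∧
    ∀ x : M, φ.Realize (Sum.elim (fun s : S => (s : M)) (fun _ => x)) ↔ x = d

/-- The quantifier-free definable closure `dcl^qf_M(S)`: the least subset of `M` that contains `S`
and contains every element which is quantifier-free definable in `M` over it. (The operator is
iterated, as it must be in order to be a closure operator: an element defined without quantifiers
from `d`, where `d` is defined without quantifiers over `S`, need not itself be the unique solution
of a quantifier-free formula over `S`.) -/
def qfDcl (L : FirstOrder.Language.{0, 0}) {M : Type u} [L.Structure M] (S : Set M) : Set M :=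
  ⋂₀ {T : Set M | S ⊆ T ∧ ∀ d, QFDefinableOver L T d → d ∈ T}

/-! ### The reinforced construction principle -/

namespace AlgVariety

variable {L : FirstOrder.Language.{0, 0}} (V : AlgVariety L)

/-- The algebras `A ≤ B`, with free generators `a i` of `A` and `b i` of `B`, witness the
reinforced construction principle. -/
structure IsRCPPair {B : Type u} [L.Structure B] (A : L.Substructure B) (a : ℕ → A)
    (b : ℕ → B) : Prop where
  /-- `A` is freely generated by the `a i`. -/
  free_left : V.FreelyGenerates a
  /-- `B` is freely generated by the `b i`. -/
  free_right : V.FreelyGenerates b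
  /-- Finite initial segments of the generators of `A` generate free factors of `B`. -/
  freeFactor : ∀ i : ℕ, V.FreeFactor
    (FirstOrder.Language.Substructure.closure L ((fun j => (a j : B)) '' Set.Iic i))
  /-- `A` is not a free factor of `P = B ∗ C`, for any free algebra `C`. -/
  not_freeFactor : ∀ (P : Type u) [L.Structure P] (e : B ↪[L] P) (C : L.Substructure P),
    V.IsFree C → V.IsFreeProduct e.toHom.range C → ¬ V.FreeFactor (A.map e.toHom)
  /-- `dcl^qf_B(A b₀) = B`. -/
  qfDcl_eq : qfDcl L ((A : Set B) ∪ {b 0}) = Set.univ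

/-- The reinforced construction principle for `V`. -/
def RCP : Prop :=
  ∃ (B : Type u) (_ : L.Structure B) (A : L.Substructure B) (a : ℕ → A) (b : ℕ → B),
    V.IsRCPPair A a b

end AlgVariety

/-! ### Abstract elementary classes -/

/-- A class of `L`-structures together with, for every `L`-structure `M`, a set of distinguished
substructures of `M`: those `A` with `A ≼ M`. -/
structure StrongClass (L : FirstOrder.Language.{0, 0}) where
  /-- `M` belongs to the class `𝒦`. -/
  Mem : ∀ (M : Type u) [L.Structure M], Prop
  /-- `A ≼ M`. -/
  Strong : ∀ {M : Type u} [L.Structure M], L.Substructure M → Prop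

namespace StrongClass

variable {L : FirstOrder.Language.{0, 0}} (K : StrongClass.{u} L)

/-- `A ≼ B`, for substructures `A` and `B` of a common structure. -/
def StrongIn {M : Type u} [L.Structure M] (A B : L.Substructure M) : Prop :=
  A ≤ B ∧ K.Strong (A.comap B.subtype.toHom)

/-- `(𝒦, ≼)` is an abstract elementary class. -/
structure IsAEC : Prop where
  /-- `≼` is a relation on `𝒦`. -/
  mem_of_strong : ∀ {M : Type u} [L.Structure M] (A : L.Substructure M),
    K.Strong A → K.Mem A ∧ K.Mem M
  /-- `𝒦` is closed under isomorphism. -/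
  mem_equiv : ∀ {M N : Type u} [L.Structure M] [L.Structure N] (_ : M ≃[L] N),
    K.Mem M → K.Mem N
  /-- `≼` is closed under isomorphism. -/
  strong_equiv : ∀ {M N : Type u} [L.Structure M] [L.Structure N] (e : M ≃[L] N)
    (A : L.Substructure M), K.Strong A → K.Strong (A.map e.toHom)
  /-- `≼` is reflexive. -/
  refl : ∀ {M : Type u} [L.Structure M], K.Mem M → K.Strong (⊤ : L.Substructure M)
  /-- `≼` is transitive. (Antisymmetry is automatic.) -/
  trans : ∀ {M : Type u} [L.Structure M] (A B : L.Substructure M),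
    K.StrongIn A B → K.Strong B → K.Strong A
  /-- The Tarski–Vaught axioms, for increasing continuous chains indexed by a nonempty
  well-order: the union is in `𝒦`, it is a strong extension of all members of the chain, and
  (smoothness) it is a strong submodel of any common strong extension. -/
  chain : ∀ {N : Type u} [L.Structure N] {ι : Type u} [LinearOrder ι] [WellFoundedLT ι]
    [Nonempty ι] (A : ι → L.Substructure N),
    (∀ i j, i ≤ j → K.StrongIn (A i) (A j)) →
    (∀ i, Order.IsSuccLimit i → A i = ⨆ j : Set.Iio i, A j) →
    K.Mem (⨆ i, A i : L.Substructure N) ∧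
    (∀ j, K.StrongIn (A j) (⨆ i, A i)) ∧
    ((∀ i, K.Strong (A i)) → K.Strong (⨆ i, A i))
  /-- The coherence axiom. -/
  coherence : ∀ {M : Type u} [L.Structure M] (A B : L.Substructure M),
    K.Strong A → K.Strong B → A ≤ B → K.StrongIn A B
  /-- The Löwenheim–Skolem–Tarski axiom. -/
  lowenheimSkolem : ∃ κ : Cardinal.{u}, ℵ₀ ≤ κ ∧ Cardinal.lift.{u} L.card ≤ κ ∧
    ∀ {M : Type u} [L.Structure M], K.Mem M → ∀ S : Set M,
      ∃ C : L.Substructure M, S ⊆ C ∧ K.Strong C ∧ #C ≤ #S + κ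

/-- A strong embedding: its image is a strong submodel of the target. -/
def IsStrongEmbedding {M N : Type u} [L.Structure M] [L.Structure N] (f : M ↪[L] N) : Prop :=
  K.Strong f.toHom.range

/-- The amalgamation property. -/
def AP : Prop :=
  ∀ (M₀ M₁ M₂ : Type u) [L.Structure M₀] [L.Structure M₁] [L.Structure M₂],
    K.Mem M₀ → K.Mem M₁ → K.Mem M₂ →
    ∀ (f₁ : M₀ ↪[L] M₁) (f₂ : M₀ ↪[L] M₂), K.IsStrongEmbedding f₁ → K.IsStrongEmbedding f₂ →
    ∃ (N : Type u) (_ : L.Structure N) (g₁ : M₁ ↪[L] N) (g₂ : M₂ ↪[L] N), K.Mem N ∧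
      K.IsStrongEmbedding g₁ ∧ K.IsStrongEmbedding g₂ ∧ ∀ x, g₁ (f₁ x) = g₂ (f₂ x)

/-- The joint embedding property. -/
def JEP : Prop :=
  ∀ (M₁ M₂ : Type u) [L.Structure M₁] [L.Structure M₂], K.Mem M₁ → K.Mem M₂ →
    ∃ (N : Type u) (_ : L.Structure N) (g₁ : M₁ ↪[L] N) (g₂ : M₂ ↪[L] N), K.Mem N ∧
      K.IsStrongEmbedding g₁ ∧ K.IsStrongEmbedding g₂

/-! ### Monster models, Galois types, superstability -/

/-- `M ∈ 𝒦` is a monster model at `κ`: it is `(κ, ≼)`-universal and `(κ, ≼)`-homogeneous. -/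
structure IsMonster (κ : Cardinal.{u}) (M : Type u) [L.Structure M] : Prop where
  mem : K.Mem M
  universal : ∀ (C : Type u) [L.Structure C], K.Mem C → #C ≤ κ →
    ∃ f : C ↪[L] M, K.IsStrongEmbedding f
  homogeneous : ∀ A₀ A₁ : L.Substructure M, K.Strong A₀ → K.Strong A₁ → #A₀ < κ → #A₁ < κ →
    ∀ f : A₀ ≃[L] A₁, ∃ π : M ≃[L] M, ∀ x : A₀, π x = f x

/-- `a` and `b` have the same orbit under the automorphisms of `M` that fix `A` pointwise. -/
def SameOrbit {M : Type u} [L.Structure M] (A : L.Substructure M) (a b : M) : Prop :=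
  ∃ π : M ≃[L] M, (∀ x ∈ A, π x = x) ∧ π a = b

/-- The set of Galois types over `A`, computed in `M`: orbits of elements of `M` under the
automorphisms of `M` that fix `A` pointwise. -/
def OrbitTypes {M : Type u} [L.Structure M] (A : L.Substructure M) : Type u :=
  Quot (SameOrbit A)

/-- Superstability in terms of types computed in monster models: on a tail of cardinals `lam`, in
some monster model at some `κ > lam` there are at most `lam` Galois types over each strong submodel
of size `lam`. -/
def MonsterSuperstable : Prop :=
  ∃ μ : Cardinal.{u}, ∀ lam : Cardinal.{u}, μ ≤ lam →
    ∃ κ : Cardinal.{u}, lam < κ ∧ ∃ (M : Type u) (_ : L.Structure M), K.IsMonster κ M ∧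
      ∀ A : L.Substructure M, K.Strong A → #A = lam → #(OrbitTypes A) ≤ lam

/-- An element `pt` of a strong extension of `A` (given by a strong embedding of `A`). -/
structure PointedExt (A : Type u) [L.Structure A] where
  /-- the extension -/
  N : Type u
  /-- its structure -/
  str : L.Structure N
  mem : K.Mem N
  /-- the embedding of `A` -/
  emb : A ↪[L] N
  strong : K.IsStrongEmbedding emb
  /-- the element -/
  pt : N

/-- Two pointed strong extensions of `A` can be amalgamated over `A` with identification of their
points. -/
def SameGaloisType {A : Type u} [L.Structure A] (p q : K.PointedExt A) : Prop :=
  letI := p.str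
  letI := q.str
  ∃ (P : Type u) (_ : L.Structure P) (g : p.N ↪[L] P) (h : q.N ↪[L] P), K.Mem P ∧
    K.IsStrongEmbedding g ∧ K.IsStrongEmbedding h ∧
    (∀ x, g (p.emb x) = h (q.emb x)) ∧ g p.pt = h q.pt

/-- The Galois types over the model `A`, defined without reference to a monster model. -/
def GaloisTypes (A : Type u) [L.Structure A] : Type (u + 1) :=
  Quot (K.SameGaloisType (A := A))

/-- `(𝒦, ≼)` is stable in `lam`: over each model of size `lam` there are at most `lam` types. -/
def StableIn (lam : Cardinal.{u}) : Prop :=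
  ∀ (A : Type u) [L.Structure A], K.Mem A → #A = lam →
    #(K.GaloisTypes A) ≤ Cardinal.lift.{u + 1} lam

/-- `(𝒦, ≼)` is superstable: it is stable on a tail of cardinals. -/
def Superstable : Prop :=
  ∃ μ : Cardinal.{u}, ∀ lam : Cardinal.{u}, μ ≤ lam → K.StableIn lam

/-! ### Coverings -/

/-- `(𝒦, ≼)` is an AEC-covering of `(𝓕_V, ≤∗^ff)`. -/
structure IsCovering (V : AlgVariety L) : Prop where
  mem_of_isFreeInf : ∀ (M : Type u) [L.Structure M], V.IsFreeInf M → K.Mem M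
  isAEC : K.IsAEC
  strong_of_freeFactor : ∀ (B : Type u) [L.Structure B] (A : L.Substructure B),
    K.Mem A → K.Mem B → V.FreeFactor A → K.Strong A
  ap : K.AP
  jep : K.JEP

/-- The covering `(𝒦, ≼)` of `(𝓕_V, ≤∗^ff)` is strong enough. -/
structure IsStrongEnough (V : AlgVariety L) : Prop where
  /-- `A ≼ B` implies `A ∗ C ≼ B ∗ C`. Here `B ∗ C = P`, and `A ∗ C` is the subalgebra of `P`
  generated by `A` and `C`. -/
  freeProduct : ∀ (P : Type u) [L.Structure P] (A B C : L.Substructure P),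
    V.IsFreeInf A → V.IsFreeInf B → V.IsFreeInf C → V.IsFreeProduct B C →
    K.StrongIn A B → K.Strong (A ⊔ C)
  /-- If `(A, B)` witnesses the reinforced construction principle and `B ≼ M`, then
  `dcl^qf_B(A b₀) = dcl^qf_M(A b₀)`. -/
  qfDcl_eq : ∀ (M : Type u) [L.Structure M] (B : L.Substructure M) (A : L.Substructure B)
    (a : ℕ → A) (b : ℕ → B), V.IsRCPPair A a b → K.Strong B →
    Subtype.val '' qfDcl L ((A : Set B) ∪ {b 0}) =
      qfDcl L ((Subtype.val '' (A : Set B)) ∪ {(b 0 : M)})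
  /-- If `(A, B)` witnesses the reinforced construction principle, `B ≼ M` for a (large enough)
  monster model `M`, and `f` is an automorphism of `M` that fixes `A` pointwise, then
  `dcl^qf_M(A b₀) = dcl^qf_M(A f(b₀))`. -/
  qfDcl_automorphism : ∃ κ₀ : Cardinal.{u}, ∀ κ : Cardinal.{u}, κ₀ ≤ κ →
    ∀ (M : Type u) [L.Structure M], K.IsMonster κ M →
    ∀ (B : L.Substructure M) (A : L.Substructure B) (a : ℕ → A) (b : ℕ → B),
    V.IsRCPPair A a b → K.Strong B →
    ∀ f : M ≃[L] M, (∀ x : A, f ((x : B) : M) = ((x : B) : M)) →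
    qfDcl L ((Subtype.val '' (A : Set B)) ∪ {(b 0 : M)}) =
      qfDcl L ((Subtype.val '' (A : Set B)) ∪ {f (b 0 : M)})

end StrongClass

/-! Types are coded by the branches of a tree. Take `lam` of cofinality ω, so that `lam < lam ^ ℵ₀`,
and let `F` be free on the finite sequences over a set of size `lam`. For each branch, identify the
generators of `F` along it with the generators `a` of an RCP pair `A ≤ B`. Then `F` becomes `A ∗ D`
inside `B ∗ D`, where `D` is generated by the nodes off the branch. Each `⟨a 0, …, a n⟩ ∗ D` is a
free factor of `B ∗ D`, so smoothness gives `F ≼ B ∗ D` (`strong_closure`). The branch is assigned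
the type of `b 0` over `F`.

Distinct branches give distinct types (`point_ne_of_branch`). Suppose an amalgam over `F` identifies
the points of two branches that part after level `n`. In each extension take a copy of `P = B ∗ D`,
now with `D` of countable rank and placed on the tail of the other branch. Both copies contain the
same `A ∗ D`, generated by the nodes of the two branches, and the same `b 0`. Since `A ∗ D ≤ B ∗ D`
is again an RCP pair (`extend`), each copy is the quantifier-free definable closure of that common
set, so the copies coincide. Comparing them yields an automorphism of `P` that fixes `a 0, …, a n`
and carries the later `a k` onto the generators of `D`. As `a 0, …, a n` and `D` together are part
of a basis of `P`, so is the image of `a`, hence `a` itself. This makes `A` a free factor of `B ∗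
D`, against RCP. -/

section

open FirstOrder.Language

/-! ### Free generation and independence of families. -/

namespace AlgVariety

variable {L : FirstOrder.Language.{0, 0}} (V : AlgVariety L)

/-- The variety has an algebra with more than one element. -/
def IsNontrivial : Prop :=
  ∃ (D : Type u) (_ : L.Structure D), V.Mem D ∧ Nontrivial D

/-- Terms agree on the family `z` only if the variety satisfies the corresponding identity. -/
def Indep {M : Type u} [L.Structure M] {ι : Type*} (z : ι → M) : Prop :=
  ∀ s t : L.Term ι, s.realize z = t.realize z →
    ∀ (D : Type u) [L.Structure D], V.Mem D → ∀ v : ι → D, s.realize v = t.realize v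

variable {V} {M N P : Type u} [L.Structure M] [L.Structure N] [L.Structure P]

theorem realize_comp_hom (f : M →[L] N) {ι : Type*} (z : ι → M) (t : L.Term ι) :
    t.realize (fun i => f (z i)) = f (t.realize z) :=
  HomClass.realize_term (v := z) f

theorem Mem.of_injective (hN : V.Mem N) (f : M →[L] N) (hf : Function.Injective f) : V.Mem M := by
  intro e he v
  apply hf
  rw [← realize_comp_hom, ← realize_comp_hom]
  exact hN e he _

theorem Mem.substructure (hN : V.Mem N) (A : L.Substructure N) : V.Mem A :=
  hN.of_injective A.subtype.toHom A.subtype.injective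

theorem Mem.equiv (hN : V.Mem N) (φ : N ≃[L] M) : V.Mem M :=
  hN.of_injective φ.symm.toHom φ.symm.injective

theorem Indep.comp_hom {ι : Type*} {z : ι → M} (f : M →[L] N)
    (hz : V.Indep (fun i => f (z i))) : V.Indep z := by
  intro s t hst
  refine hz s t ?_
  rw [realize_comp_hom, realize_comp_hom, hst]

theorem Indep.map {ι : Type*} {z : ι → M} (hz : V.Indep z) (f : M →[L] N)
    (hf : Function.Injective f) : V.Indep (fun i => f (z i)) := by
  intro s t hst
  rw [realize_comp_hom, realize_comp_hom] at hst
  exact hz s t (hf hst)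

theorem Indep.comp_injective {ι κ : Type*} {z : ι → M} (hz : V.Indep z) (σ : κ → ι)
    (hσ : Function.Injective σ) : V.Indep (z ∘ σ) := by
  intro s t hst D _ hD v
  -- Variables outside the range of `σ` need a default value; the value of `s` shows that `D` has a
  -- point even when `κ` is empty.
  have : Nonempty D := ⟨s.realize v⟩
  have h := hz (s.relabel σ) (t.relabel σ) (by simpa using hst) D hD
    (Function.extend σ v (fun _ => Classical.arbitrary D))
  rw [Term.realize_relabel, Term.realize_relabel] at h
  rwa [show Function.extend σ v (fun _ => Classical.arbitrary D) ∘ σ = v from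
    funext fun i => hσ.extend_apply _ _ _] at h

namespace FreelyGenerates

variable {ι κ : Type*} {x : ι → M}

theorem hom_ext (hx : V.FreelyGenerates x) {D : Type u} [L.Structure D] (hD : V.Mem D)
    {f g : M →[L] D} (h : ∀ i, f (x i) = g (x i)) : f = g :=
  (hx.lift D hD (fun i => g (x i))).unique h (fun _ => rfl)

theorem exists_hom (hx : V.FreelyGenerates x) {D : Type u} [L.Structure D] (hD : V.Mem D)
    (v : ι → D) : ∃ f : M →[L] D, ∀ i, f (x i) = v i :=
  (hx.lift D hD v).exists

/-- Mapping `M` into the closure and including back fixes the generators, hence is the identity. -/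
theorem closure_eq_top (hx : V.FreelyGenerates x) :
    Substructure.closure L (Set.range x) = ⊤ := by
  set S := Substructure.closure L (Set.range x)
  obtain ⟨f, hf⟩ := hx.exists_hom (hx.mem.substructure S)
    (fun i => ⟨x i, Substructure.subset_closure (Set.mem_range_self i)⟩)
  have h : S.subtype.toHom.comp f = Hom.id L M := by
    apply hx.hom_ext hx.mem
    intro i
    simp [hf]
  rw [eq_top_iff]
  intro m _
  have := DFunLike.congr_fun h m
  simp only [Hom.comp_apply, Hom.id_apply] at this
  rw [← this]
  exact (f m).2

theorem indep (hx : V.FreelyGenerates x) : V.Indep x := by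
  intro s t hst D _ hD v
  obtain ⟨f, hf⟩ := hx.exists_hom hD v
  obtain rfl : (fun i => f (x i)) = v := funext hf
  rw [realize_comp_hom, realize_comp_hom, hst]

end FreelyGenerates

theorem exists_term_of_mem_closure {ι : Type*} {z : ι → M} {m : M}
    (hm : m ∈ Substructure.closure L (Set.range z)) : ∃ t : L.Term ι, t.realize z = m := by
  rw [Substructure.mem_closure_iff_exists_term] at hm
  obtain ⟨t, rfl⟩ := hm
  refine ⟨t.relabel (fun y => y.2.choose), ?_⟩
  rw [Term.realize_relabel]
  congr 1
  funext y
  exact y.2.choose_spec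

/-- Injectivity is automatic: a lift can send two different indices to different points of a
nontrivial algebra. -/
theorem freelyGenerates_of_lift (hV : V.IsNontrivial.{u}) {ι : Type*} {x : ι → M} (hM : V.Mem M)
    (hl : ∀ (D : Type u) [L.Structure D], V.Mem D → ∀ v : ι → D,
      ∃! h : M →[L] D, ∀ i, h (x i) = v i) : V.FreelyGenerates x := by
  refine ⟨hM, ?_, hl⟩
  intro i j hij
  by_contra hne
  obtain ⟨D, _, hD, p, q, hpq⟩ := hV
  classical
  obtain ⟨h, hh, -⟩ := hl D hD (Function.update (fun _ => p) i q)
  have h1 := hh i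
  have h2 := hh j
  rw [hij, h2] at h1
  simp [Function.update_of_ne (Ne.symm hne), hpq] at h1

namespace FreelyGenerates

theorem reindex {ι κ : Type*} {x : ι → M} (hx : V.FreelyGenerates x) (σ : κ ≃ ι) :
    V.FreelyGenerates (x ∘ σ) := by
  refine ⟨hx.mem, hx.injective.comp σ.injective, fun D _ hD v => ?_⟩
  obtain ⟨h, hh, hu⟩ := hx.lift D hD (v ∘ σ.symm)
  refine ⟨h, fun i => by simp [hh], fun g hg => hu g fun i => ?_⟩
  simpa using hg (σ.symm i)

end FreelyGenerates

variable [L.IsAlgebraic]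

/-- The lift evaluates at `v` a term chosen to represent the element; independence makes the choice
immaterial, so the map respects operations. -/
theorem freelyGenerates_of_indep (hV : V.IsNontrivial.{u}) {ι : Type*} {x : ι → M}
    (hM : V.Mem M) (hx : V.Indep x) (ht : ∀ m, ∃ t : L.Term ι, t.realize x = m) :
    V.FreelyGenerates x := by
  refine freelyGenerates_of_lift hV hM ?_
  intro D _ hD v
  choose t ht using ht
  refine ⟨⟨fun m => (t m).realize v, ?_, fun r => isEmptyElim r⟩, ?_, ?_⟩
  · intro n f y
    have := hx (t (Structure.funMap f y)) (Term.func f fun i => t (y i)) (by simp [ht]) D hD v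
    simpa [Function.comp_def] using this
  · intro i
    exact hx (t (x i)) (Term.var i) (by simp [ht]) D hD v
  · intro g hg
    ext m
    obtain rfl : (fun i => g (x i)) = v := funext hg
    change g m = (t m).realize _
    rw [realize_comp_hom, ht]

theorem Indep.freelyGenerates_closure (hV : V.IsNontrivial.{u}) {ι : Type*} {x : ι → M}
    (hx : V.Indep x) (hM : V.Mem (Substructure.closure L (Set.range x))) :
    V.FreelyGenerates (fun i => (⟨x i, Substructure.subset_closure (Set.mem_range_self i)⟩ :
      Substructure.closure L (Set.range x))) := by
  refine freelyGenerates_of_indep hV hM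
    (Indep.comp_hom (Substructure.closure L (Set.range x)).subtype.toHom hx) ?_
  rintro ⟨m, hm⟩
  obtain ⟨t, rfl⟩ := exists_term_of_mem_closure hm
  refine ⟨t, Subtype.ext ?_⟩
  have := realize_comp_hom (Substructure.closure L (Set.range x)).subtype.toHom
    (fun i => (⟨x i, Substructure.subset_closure (Set.mem_range_self i)⟩ :
      Substructure.closure L (Set.range x))) t
  exact this.symm

end AlgVariety

/-! ### Bases, free products and free factors. -/

namespace AlgVariety

variable {L : FirstOrder.Language.{0, 0}} {V : AlgVariety L}
  {M N P : Type u} [L.Structure M] [L.Structure N] [L.Structure P]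

namespace FreelyGenerates

variable {ι κ : Type*} {x : ι → M}

theorem map_equiv (hx : V.FreelyGenerates x) (φ : M ≃[L] N) :
    V.FreelyGenerates (fun i => φ (x i)) := by
  refine ⟨hx.mem.equiv φ, φ.injective.comp hx.injective, fun D _ hD v => ?_⟩
  obtain ⟨h, hh, hu⟩ := hx.lift D hD v
  refine ⟨h.comp φ.symm.toHom, fun i => by simp [hh], fun g hg => ?_⟩
  have := hu (g.comp φ.toHom) fun i => by simp [hg]
  rw [← this]
  ext y
  simp

theorem exists_equiv (hx : V.FreelyGenerates x) {y : ι → N} (hy : V.FreelyGenerates y) :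
    ∃ φ : M ≃[L] N, ∀ i, φ (x i) = y i := by
  obtain ⟨f, hf⟩ := hx.exists_hom hy.mem y
  obtain ⟨g, hg⟩ := hy.exists_hom hx.mem x
  have h1 : g.comp f = Hom.id L M := hx.hom_ext hx.mem fun i => by simp [hf, hg]
  have h2 : f.comp g = Hom.id L N := hy.hom_ext hy.mem fun i => by simp [hf, hg]
  have h1' : ∀ m, g (f m) = m := fun m => DFunLike.congr_fun h1 m
  have h2' : ∀ m, f (g m) = m := fun m => DFunLike.congr_fun h2 m
  refine ⟨⟨⟨f, g, h1', h2'⟩, fun h z => f.map_fun h z, fun r z => ⟨fun h => ?_, f.map_rel r z⟩⟩,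
    hf⟩
  have := g.map_rel r _ h
  convert this using 2
  funext i
  exact (h1' (z i)).symm

theorem closure_range_hom (hx : V.FreelyGenerates x) (f : M →[L] N) :
    Substructure.closure L (Set.range fun i => f (x i)) = f.range := by
  rw [Hom.range_eq_map, ← hx.closure_eq_top, Substructure.map_closure, ← Set.range_comp]
  rfl

theorem isFree (hx : V.FreelyGenerates x) : V.IsFree M := by
  refine ⟨Set.range x, _, hx.reindex (Equiv.ofInjective x hx.injective).symm⟩

theorem isFreeInf [Infinite ι] (hx : V.FreelyGenerates x) : V.IsFreeInf M := by
  refine ⟨Set.range x, _, ?_, hx.reindex (Equiv.ofInjective x hx.injective).symm⟩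
  exact Set.infinite_coe_iff.2 (Set.infinite_range_of_injective hx.injective)

theorem isNontrivial [Infinite ι] (hx : V.FreelyGenerates x) : V.IsNontrivial.{u} :=
  ⟨M, _, hx.mem, hx.injective.nontrivial⟩

/-- In a free algebra with free generators `x, y`, the generators `x` may be exchanged for any free
generators of the subalgebra they generate. -/
theorem exchange (hV : V.IsNontrivial.{u}) {κ' : Type*} {b : ι → N} {b' : κ' → N} {e : N →[L] P}
    {d : κ → P} (h : V.FreelyGenerates (Sum.elim (fun i => e (b i)) d)) (hb : V.FreelyGenerates b)
    (hb' : V.FreelyGenerates b') : V.FreelyGenerates (Sum.elim (fun i => e (b' i)) d) := by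
  refine freelyGenerates_of_lift hV h.mem fun D _ hD v => ?_
  obtain ⟨f, hf⟩ := hb'.exists_hom hD (fun i => v (Sum.inl i))
  obtain ⟨g, hg⟩ := h.exists_hom hD (Sum.elim (fun i => f (b i)) (fun i => v (Sum.inr i)))
  have hgf : g.comp e = f := hb.hom_ext hD fun i => by simpa using hg (Sum.inl i)
  have hgf' : ∀ m, g (e m) = f m := fun m => DFunLike.congr_fun hgf m
  refine ⟨g, ?_, fun g' hg' => h.hom_ext hD ?_⟩
  · rintro (i | i)
    · simp [hgf', hf]
    · simpa using hg (Sum.inr i)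
  · have : g'.comp e = f := hb'.hom_ext hD fun i => by simpa [hf] using hg' (Sum.inl i)
    have this' : ∀ m, g' (e m) = f m := fun m => DFunLike.congr_fun this m
    rintro (i | i)
    · simp [hgf', this']
    · exact (hg' (Sum.inr i)).trans (hg (Sum.inr i)).symm

end FreelyGenerates

theorem IsFreeProduct.freelyGenerates (hV : V.IsNontrivial.{u}) {A C : L.Substructure P}
    (h : V.IsFreeProduct A C) {ι κ : Type*} {x : ι → A} {y : κ → C} (hx : V.FreelyGenerates x)
    (hy : V.FreelyGenerates y) :
    V.FreelyGenerates (Sum.elim (fun i => (x i : P)) (fun i => (y i : P))) := by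
  refine freelyGenerates_of_lift hV h.1 fun D _ hD v => ?_
  obtain ⟨f, hf⟩ := hx.exists_hom hD (fun i => v (Sum.inl i))
  obtain ⟨g, hg⟩ := hy.exists_hom hD (fun i => v (Sum.inr i))
  obtain ⟨k, ⟨hk1, hk2⟩, hu⟩ := h.2 D hD f g
  refine ⟨k, ?_, fun k' hk' => hu k' ⟨fun m => ?_, fun m => ?_⟩⟩
  · rintro (i | i)
    · simp [hk1, hf]
    · simp [hk2, hg]
  · have : k'.comp A.subtype.toHom = f := hx.hom_ext hD fun i => by simpa [hf] using hk' (Sum.inl i)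
    exact DFunLike.congr_fun this m
  · have : k'.comp C.subtype.toHom = g := hy.hom_ext hD fun i => by simpa [hg] using hk' (Sum.inr i)
    exact DFunLike.congr_fun this m

/-- Free generators of a free factor extend to free generators of the whole algebra. -/
theorem FreeFactor.exists_extension (hV : V.IsNontrivial.{u}) {A : L.Substructure P}
    (h : V.FreeFactor A) {ι : Type*} {x : ι → A} (hx : V.FreelyGenerates x) :
    ∃ (κ : Type u) (y : κ → P), V.FreelyGenerates (Sum.elim (fun i => (x i : P)) y) := by
  obtain ⟨-, -, C, ⟨κ, y, hy⟩, hAC⟩ := h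
  exact ⟨κ, _, hAC.freelyGenerates hV hx hy⟩

variable [L.IsAlgebraic]

namespace FreelyGenerates

variable {ι κ : Type*}

theorem freelyGenerates_closure_comp (hV : V.IsNontrivial.{u}) {z : ι → P}
    (h : V.FreelyGenerates z) {σ : κ → ι} (hσ : Function.Injective σ) :
    V.FreelyGenerates (fun i => (⟨(z ∘ σ) i, Substructure.subset_closure (Set.mem_range_self i)⟩ :
      Substructure.closure L (Set.range (z ∘ σ)))) :=
  (h.indep.comp_injective σ hσ).freelyGenerates_closure hV (h.mem.substructure _)

theorem isFreeProduct (hV : V.IsNontrivial.{u}) {x : ι → P} {y : κ → P}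
    (h : V.FreelyGenerates (Sum.elim x y)) :
    V.IsFreeProduct (Substructure.closure L (Set.range x))
      (Substructure.closure L (Set.range y)) := by
  have hx := h.freelyGenerates_closure_comp hV (Sum.inl_injective)
  have hy := h.freelyGenerates_closure_comp hV (Sum.inr_injective)
  refine ⟨h.mem, fun D _ hD f g => ?_⟩
  obtain ⟨k, hk⟩ := h.exists_hom hD (Sum.elim
    (fun i => f ⟨x i, Substructure.subset_closure (Set.mem_range_self i)⟩)
    (fun i => g ⟨y i, Substructure.subset_closure (Set.mem_range_self i)⟩))
  have h1 : k.comp (Substructure.closure L (Set.range x)).subtype.toHom = f :=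
    hx.hom_ext hD fun i => hk (Sum.inl i)
  have h2 : k.comp (Substructure.closure L (Set.range y)).subtype.toHom = g :=
    hy.hom_ext hD fun i => hk (Sum.inr i)
  refine ⟨k, ⟨fun a => DFunLike.congr_fun h1 a, fun a => DFunLike.congr_fun h2 a⟩, ?_⟩
  rintro k' ⟨h1', h2'⟩
  refine h.hom_ext hD ?_
  rintro (i | i)
  · rw [hk]
    exact h1' ⟨x i, Substructure.subset_closure (Set.mem_range_self i)⟩
  · rw [hk]
    exact h2' ⟨y i, Substructure.subset_closure (Set.mem_range_self i)⟩

theorem freeFactor (hV : V.IsNontrivial.{u}) {x : ι → P} {y : κ → P}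
    (h : V.FreelyGenerates (Sum.elim x y)) :
    V.FreeFactor (Substructure.closure L (Set.range x)) :=
  ⟨(h.freelyGenerates_closure_comp hV (Sum.inl_injective)).isFree, h.isFree, _,
    (h.freelyGenerates_closure_comp hV (Sum.inr_injective)).isFree, h.isFreeProduct hV⟩

theorem exists_embedding_of_indep (hV : V.IsNontrivial.{u}) {x : ι → M}
    (hx : V.FreelyGenerates x) (hN : V.Mem N) {z : ι → N} (hz : V.Indep z) :
    ∃ f : M ↪[L] N, (∀ i, f (x i) = z i) ∧
      f.toHom.range = Substructure.closure L (Set.range z) := by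
  obtain ⟨φ, hφ⟩ := hx.exists_equiv (hz.freelyGenerates_closure hV (hN.substructure _))
  have hf : ∀ i, ((Substructure.subtype _).comp φ.toEmbedding) (x i) = z i := fun i => by
    simp [hφ]
  refine ⟨_, hf, ?_⟩
  rw [← hx.closure_range_hom]
  congr 2
  funext i
  exact hf i

/-- The members of the basis outside `S` generate a complement. -/
theorem freeFactor_closure_of_subset (hV : V.IsNontrivial.{u}) {y : κ → P}
    (hy : V.FreelyGenerates y) {S : Set P} (hS : S ⊆ Set.range y) :
    V.FreeFactor (Substructure.closure L S) := by
  choose σ hσ using fun s : S => hS s.2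
  have hσ' : Function.Injective σ := fun s t hst => Subtype.ext (by rw [← hσ, hst, hσ])
  classical
  have h := hy.reindex ((Equiv.sumCongr (Equiv.ofInjective σ hσ') (Equiv.refl _)).trans
    (Equiv.Set.sumCompl (Set.range σ)))
  have key : V.FreelyGenerates (Sum.elim (Subtype.val : S → P)
      (fun i : ((Set.range σ)ᶜ : Set κ) => y i)) := by
    convert h using 1
    funext i
    rcases i with i | i <;> simp [hσ]
  simpa using key.freeFactor hV

theorem exists_embedding (hV : V.IsNontrivial.{u}) {x : ι → M} (hx : V.FreelyGenerates x)
    {y : κ → N} (hy : V.FreelyGenerates y) {σ : ι → κ} (hσ : Function.Injective σ) :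
    ∃ f : M ↪[L] N, (∀ i, f (x i) = y (σ i)) ∧ V.FreeFactor f.toHom.range := by
  obtain ⟨f, hf, hr⟩ := hx.exists_embedding_of_indep hV hy.mem (hy.indep.comp_injective σ hσ)
  refine ⟨f, hf, ?_⟩
  rw [hr]
  exact hy.freeFactor_closure_of_subset hV (Set.range_comp_subset_range _ _)

end FreelyGenerates

/-! ### Existence of free algebras. -/

/-- Two terms over `ι` are identified if the identity they express holds in the variety. -/
def termSetoid (V : AlgVariety L) (ι : Type u) : Setoid (L.Term ι) where
  r s t := ∀ (D : Type u) [L.Structure D], V.Mem D → ∀ v : ι → D, s.realize v = t.realize v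
  iseqv := ⟨fun _ _ _ _ _ => rfl, fun h D _ hD v => (h D hD v).symm,
    fun h h' D _ hD v => (h D hD v).trans (h' D hD v)⟩

/-- The free algebra of `V` on `ι`. -/
def FreeAlgebra (V : AlgVariety L) (ι : Type u) : Type u := Quotient (termSetoid V ι)

noncomputable instance (V : AlgVariety L) (ι : Type u) : L.Structure (FreeAlgebra V ι) where
  funMap f y := Quotient.mk _ (Term.func f fun i => (y i).out)
  RelMap r := isEmptyElim r

/-- The operations are defined through chosen representatives; equivalent terms agree in every
algebra of `V`, so the choice does not matter. -/
theorem FreeAlgebra.funMap_mk {ι : Type u} {n : ℕ} (f : L.Functions n) (t : Fin n → L.Term ι) :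
    (Structure.funMap f (fun i => (Quotient.mk _ (t i) : FreeAlgebra V ι)) : FreeAlgebra V ι) =
      Quotient.mk _ (Term.func f t) := by
  refine Quotient.sound ?_
  intro D _ hD v
  simp only [Term.realize_func]
  congr 1
  funext i
  exact Quotient.exact (Quotient.out_eq (Quotient.mk (termSetoid V ι) (t i))) D hD v

theorem FreeAlgebra.realize_mk {ι : Type u} {κ : Type*} (t : L.Term κ) (v : κ → L.Term ι) :
    t.realize (M := FreeAlgebra V ι) (fun i => Quotient.mk _ (v i)) =
      Quotient.mk _ (t.subst v) := by
  induction t with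
  | var i => rfl
  | func f ts ih =>
    exact (congrArg (Structure.funMap f) (funext ih)).trans (funMap_mk f _)

theorem exists_freelyGenerates (hV : V.IsNontrivial.{u}) (ι : Type u) :
    ∃ (F : Type u) (_ : L.Structure F) (x : ι → F), V.FreelyGenerates x := by
  refine ⟨FreeAlgebra V ι, inferInstance, fun i => Quotient.mk _ (Term.var i),
    freelyGenerates_of_indep hV ?_ ?_ ?_⟩
  · intro e he v
    obtain ⟨w, rfl⟩ : ∃ w : ℕ → L.Term ι, v = fun i => Quotient.mk _ (w i) :=
      ⟨fun i => (v i).out, funext fun i => (Quotient.out_eq _).symm⟩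
    rw [FreeAlgebra.realize_mk, FreeAlgebra.realize_mk]
    refine Quotient.sound fun D _ hD v => ?_
    rw [Term.realize_subst, Term.realize_subst]
    exact hD e he _
  · intro s t hst D _ hD v
    rw [FreeAlgebra.realize_mk, FreeAlgebra.realize_mk] at hst
    simpa [Term.realize_subst] using Quotient.exact hst D hD v
  · intro m
    obtain ⟨t, rfl⟩ := Quotient.exists_rep m
    refine ⟨t, ?_⟩
    rw [FreeAlgebra.realize_mk]
    refine Quotient.sound fun D _ hD v => ?_
    simp [Term.realize_subst]

end AlgVariety

/-! ### Quantifier-free definable closure. -/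

section QFDcl

variable {L : FirstOrder.Language.{0, 0}} {M N : Type u} [L.Structure M] [L.Structure N]

theorem QFDefinableOver.mono {S T : Set M} (h : S ⊆ T) {d : M} (hd : QFDefinableOver L S d) :
    QFDefinableOver L T d := by
  obtain ⟨φ, hφ, hd⟩ := hd
  refine ⟨φ.relabel (Sum.map (Set.inclusion h) id), hφ.relabel _, fun x => ?_⟩
  rw [Formula.realize_relabel, ← hd]
  exact iff_of_eq (congrArg _ (by funext i; rcases i with i | i <;> rfl))

theorem QFDefinableOver.map_equiv {T : Set N} (φ : M ≃[L] N) {d : M}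
    (hd : QFDefinableOver L (φ ⁻¹' T) d) : QFDefinableOver L T (φ d) := by
  obtain ⟨ψ, hψ, hd⟩ := hd
  refine ⟨ψ.relabel (Sum.map (fun s : φ ⁻¹' T => (⟨φ s, s.2⟩ : T)) id), hψ.relabel _, fun x => ?_⟩
  obtain ⟨x, rfl⟩ := φ.surjective x
  rw [Formula.realize_relabel, φ.injective.eq_iff, ← hd,
    ← StrongHomClass.realize_formula φ ψ]
  exact iff_of_eq (congrArg _ (by funext i; rcases i with i | i <;> rfl))

theorem subset_qfDcl (S : Set M) : S ⊆ qfDcl L S :=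
  Set.subset_sInter fun _ hT => hT.1

theorem qfDcl_subset {S T : Set M} (h : S ⊆ T) (hT : ∀ d, QFDefinableOver L T d → d ∈ T) :
    qfDcl L S ⊆ T :=
  Set.sInter_subset_of_mem ⟨h, hT⟩

theorem mem_qfDcl_of_definable {S : Set M} {d : M} (hd : QFDefinableOver L (qfDcl L S) d) :
    d ∈ qfDcl L S :=
  Set.mem_sInter.2 fun _ hT => hT.2 d (hd.mono (qfDcl_subset hT.1 hT.2))

theorem qfDcl_subset_qfDcl {S T : Set M} (h : S ⊆ qfDcl L T) : qfDcl L S ⊆ qfDcl L T :=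
  qfDcl_subset h fun _ => mem_qfDcl_of_definable

theorem qfDcl_mono {S T : Set M} (h : S ⊆ T) : qfDcl L S ⊆ qfDcl L T :=
  qfDcl_subset_qfDcl (h.trans (subset_qfDcl T))

/-- The value of an operation is the unique solution of an atomic formula over its arguments. -/
theorem closure_subset_qfDcl (S : Set M) : (Substructure.closure L S : Set M) ⊆ qfDcl L S := by
  let A : L.Substructure M :=
    { carrier := qfDcl L S
      fun_mem := fun {n} f y hy => by
        refine mem_qfDcl_of_definable ⟨Term.equal (Term.var (Sum.inr ()))
          (Term.func f fun i => Term.var (Sum.inl ⟨y i, hy i⟩)), ?_, fun x => ?_⟩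
        · exact (BoundedFormula.IsAtomic.equal _ _).isQF
        · simp [Formula.realize_equal] }
  exact (Substructure.closure_le (S := A)).2 (subset_qfDcl S)

theorem image_qfDcl_subset (φ : M ≃[L] N) (S : Set M) : φ '' qfDcl L S ⊆ qfDcl L (φ '' S) :=
  Set.image_subset_iff.2 (qfDcl_subset (Set.image_subset_iff.1 (subset_qfDcl _))
    fun _ hd => mem_qfDcl_of_definable (hd.map_equiv φ))

end QFDcl

/-! ### Algebra of RCP pairs. -/

namespace AlgVariety

variable {L : FirstOrder.Language.{0, 0}} {V : AlgVariety L} {B N P : Type u} [L.Structure B]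
  [L.Structure N] [L.Structure P]

/-- The value of a term in variables `ℕ ⊕ κ` depends only on finitely many of the variables
in `ℕ`. -/
theorem exists_bound_realize {κ : Type*} (t : L.Term (ℕ ⊕ κ)) :
    ∃ n : ℕ, ∀ m, n ≤ m → ∀ (M : Type u) [L.Structure M] (v w : ℕ ⊕ κ → M),
      (∀ i ≤ m, v (Sum.inl i) = w (Sum.inl i)) → (∀ k, v (Sum.inr k) = w (Sum.inr k)) →
      t.realize v = t.realize w := by
  induction t with
  | var i =>
    rcases i with i | k
    · exact ⟨i, fun m hm M _ v w h _ => h i hm⟩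
    · exact ⟨0, fun m hm M _ v w _ h => h k⟩
  | func f ts ih =>
    choose n hn using ih
    refine ⟨Finset.univ.sup n, fun m hm M _ v w h1 h2 => ?_⟩
    simp only [Term.realize_func]
    congr 1
    funext i
    exact hn i m ((Finset.le_sup (Finset.mem_univ i)).trans hm) M v w h1 h2

namespace IsRCPPair

variable {A : L.Substructure B} {a : ℕ → A} {b : ℕ → B}

theorem isNontrivial (h : V.IsRCPPair A a b) : V.IsNontrivial.{u} := h.free_right.isNontrivial

theorem indep (h : V.IsRCPPair A a b) : V.Indep (fun i => (a i : B)) :=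
  h.free_left.indep.map A.subtype.toHom A.subtype.injective

theorem map_eq_closure (h : V.IsRCPPair A a b) (e : B →[L] P) :
    A.map e = Substructure.closure L (Set.range fun i => e (a i)) := by
  refine Eq.trans ?_ (h.free_left.closure_range_hom (e.comp A.subtype.toHom)).symm
  rw [Hom.range_comp]
  congr 1
  ext m
  simp

end IsRCPPair

variable [L.IsAlgebraic]

theorem FreeFactor.map_equiv (hV : V.IsNontrivial.{u}) {A : L.Substructure N}
    (h : V.FreeFactor A) (φ : N ≃[L] P) : V.FreeFactor (A.map φ.toHom) := by
  obtain ⟨ι, x, hx⟩ := h.1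
  obtain ⟨κ, y, hy⟩ := h.exists_extension hV hx
  have hA : A = Substructure.closure L (Set.range fun i => (x i : N)) := by
    have := hx.closure_range_hom A.subtype.toHom
    rw [Embedding.coe_toHom, Substructure.coe_subtype] at this
    rw [this]
    ext m
    simp
  rw [hA, Substructure.map_closure]
  refine (hy.map_equiv φ).freeFactor_closure_of_subset hV ?_
  rintro _ ⟨_, ⟨i, rfl⟩, rfl⟩
  exact ⟨Sum.inl i, rfl⟩

namespace IsRCPPair

variable {A : L.Substructure B} {a : ℕ → A} {b : ℕ → B}

/-- Finite initial segments of the generators of `A` extend to free generators of `B`. -/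
theorem exists_extension (h : V.IsRCPPair A a b) (n : ℕ) : ∃ (κ : Type u) (w : κ → B),
    V.FreelyGenerates (Sum.elim (fun i : Set.Iic n => (a i : B)) w) := by
  have h1 := h.freeFactor n
  rw [Set.image_eq_range] at h1
  exact h1.exists_extension h.isNontrivial
    ((h.indep.comp_injective (Subtype.val : Set.Iic n → ℕ)
      Subtype.val_injective).freelyGenerates_closure h.isNontrivial
        (h.free_right.mem.substructure _))

theorem exists_extension_of_sum (h : V.IsRCPPair A a b) {κ : Type*} {e : B →[L] P} {d : κ → P}
    (hP : V.FreelyGenerates (Sum.elim (fun i => e (b i)) d)) (n : ℕ) :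
    ∃ (κ' : Type u) (w : κ' → P), V.FreelyGenerates
      (Sum.elim (Sum.elim (fun i : Set.Iic n => e (a i)) w) d) := by
  obtain ⟨κ', w, hw⟩ := h.exists_extension n
  refine ⟨κ', fun i => e (w i), ?_⟩
  convert hP.exchange h.isNontrivial h.free_right hw using 2
  funext i
  rcases i with i | i <;> rfl

/-- Two terms involve finitely many `a i`, and these together with `d` are part of a basis of `P`.
The whole family need not be part of one. -/
theorem indep_sum (h : V.IsRCPPair A a b) {κ : Type*} {e : B →[L] P} {d : κ → P}
    (hP : V.FreelyGenerates (Sum.elim (fun i => e (b i)) d)) :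
    V.Indep (Sum.elim (fun i => e (a i)) d) := by
  intro s t hst D _ hD v
  obtain ⟨n, hn⟩ := exists_bound_realize.{u} s
  obtain ⟨m, hm⟩ := exists_bound_realize.{u} t
  obtain ⟨κ', w, hw⟩ := h.exists_extension_of_sum hP (max n m)
  -- The value on `w` is irrelevant; `s.realize v` is merely an available element of `D`.
  obtain ⟨f, hf⟩ := hw.exists_hom hD (Sum.elim (Sum.elim (fun i => v (Sum.inl i))
    (fun _ => s.realize v)) (fun k => v (Sum.inr k)))
  have h1 : ∀ i ≤ max n m, v (Sum.inl i) = f (Sum.elim (fun i => e (a i)) d (Sum.inl i)) :=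
    fun i hi => (hf (Sum.inl (Sum.inl ⟨i, hi⟩))).symm
  have h2 : ∀ k, v (Sum.inr k) = f (Sum.elim (fun i => e (a i)) d (Sum.inr k)) :=
    fun k => (hf (Sum.inr k)).symm
  rw [hn _ (le_max_left n m) D v (fun i => f (Sum.elim (fun i => e (a i)) d i)) h1 h2,
    hm _ (le_max_right n m) D v (fun i => f (Sum.elim (fun i => e (a i)) d i)) h1 h2,
    realize_comp_hom, realize_comp_hom, hst]

/-- No free product of `B` with a free algebra has free generators that extend those of `A`. -/
theorem not_freelyGenerates (h : V.IsRCPPair A a b) {κ κ' : Type*} {e : B ↪[L] P} {d : κ → P}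
    (hP : V.FreelyGenerates (Sum.elim (fun i => e (b i)) d)) {w : κ' → P} :
    ¬ V.FreelyGenerates (Sum.elim (fun i => e (a i)) w) := by
  intro hw
  refine h.not_freeFactor P e (Substructure.closure L (Set.range d)) ?_ ?_ ?_
  · exact (hP.freelyGenerates_closure_comp h.isNontrivial Sum.inr_injective).isFree
  · have := hP.isFreeProduct h.isNontrivial
    rwa [show Substructure.closure L (Set.range fun i => e (b i)) = e.toHom.range from
      h.free_right.closure_range_hom e.toHom] at this
  · rw [h.map_eq_closure]
    exact hw.freeFactor h.isNontrivial

theorem map_equiv (h : V.IsRCPPair A a b) (φ : B ≃[L] N) :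
    V.IsRCPPair (A.map φ.toHom) (fun i => ⟨φ (a i), Substructure.mem_map_of_mem φ.toHom (a i).2⟩)
      (fun i => φ (b i)) where
  free_left := h.free_left.map_equiv (φ.toEmbedding.substructureEquivMap A)
  free_right := h.free_right.map_equiv φ
  freeFactor i := by
    have := (h.freeFactor i).map_equiv h.isNontrivial φ
    rw [Substructure.map_closure, Set.image_image] at this
    exact this
  not_freeFactor P _ e C hC hP := by
    have h1 : (e.comp φ.toEmbedding).toHom.range = e.toHom.range := by
      ext m
      simp only [Hom.mem_range]
      constructor
      · rintro ⟨y, rfl⟩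
        exact ⟨φ y, rfl⟩
      · rintro ⟨y, rfl⟩
        exact ⟨φ.symm y, by simp⟩
    have h2 := h.not_freeFactor P (e.comp φ.toEmbedding) C hC (h1 ▸ hP)
    rw [Substructure.map_map]
    exact h2
  qfDcl_eq := by
    have h1 := image_qfDcl_subset φ ((A : Set B) ∪ {b 0})
    rw [h.qfDcl_eq, Set.image_univ, φ.surjective.range_eq, Set.image_union,
      Set.image_singleton] at h1
    exact Set.univ_subset_iff.1 h1

/-- If `A ≤ B` is an RCP pair and `D` is free of countable rank, then `A ∗ D ≤ B ∗ D` is an RCP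
pair. -/
theorem extend (h : V.IsRCPPair A a b) {e : B ↪[L] P} {d : ℕ → P}
    (hP : V.FreelyGenerates (Sum.elim (fun i => e (b i)) d))
    (hd : ∀ i, e (b i) ∈ qfDcl L ((Substructure.closure L
      (Set.range (Sum.elim (fun i => e (a i)) d)) : Set P) ∪ {e (b 0)})) :
    V.IsRCPPair (Substructure.closure L (Set.range (Sum.elim (fun i => e (a i)) d)))
      (fun i => ⟨Sum.elim (fun i => e (a i)) d (Equiv.natSumNatEquivNat.symm i),
        Substructure.subset_closure (Set.mem_range_self _)⟩)
      (fun i => Sum.elim (fun i => e (b i)) d (Equiv.natSumNatEquivNat.symm i)) where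
  free_left := ((h.indep_sum (e := e.toHom) hP).freelyGenerates_closure h.isNontrivial
    (hP.mem.substructure _)).reindex Equiv.natSumNatEquivNat.symm
  free_right := hP.reindex Equiv.natSumNatEquivNat.symm
  freeFactor i := by
    obtain ⟨κ', w, hw⟩ := h.exists_extension_of_sum (e := e.toHom) hP i
    refine hw.freeFactor_closure_of_subset h.isNontrivial ?_
    rintro _ ⟨j, hj, rfl⟩
    obtain ⟨k, rfl⟩ := Equiv.natSumNatEquivNat.surjective j
    rcases k with k | k
    -- The `a k` sit at the even positions `2 * k`, so those up to position `i` have `k ≤ i`.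
    · simp only [Equiv.natSumNatEquivNat_apply, Sum.elim_inl, Set.mem_Iic] at hj
      refine ⟨Sum.inl (Sum.inl ⟨k, Set.mem_Iic.2 (by omega)⟩), ?_⟩
      simp
    · exact ⟨Sum.inr k, by simp⟩
  not_freeFactor Q _ e' C hC hQ hA := by
    obtain ⟨κ, y, hy⟩ := hC
    have h1 := hQ.freelyGenerates h.isNontrivial (hP.map_equiv e'.equivRange) hy
    obtain ⟨κ', w, hw⟩ := hA.exists_extension h.isNontrivial
      (((h.indep_sum (e := e.toHom) hP).freelyGenerates_closure h.isNontrivial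
        (hP.mem.substructure _)).map_equiv (e'.substructureEquivMap _))
    simp only [Embedding.substructureEquivMap_apply] at hw
    -- `D` is absorbed into the complement: `(B ∗ D) ∗ C` is `B ∗ (D ∗ C)`, and `a` would extend to
    -- a basis of it by `d` and `w`.
    refine h.not_freelyGenerates (e := e'.comp e)
      (d := Sum.elim (fun i => e' (d i)) (fun i => (y i : Q)))
      (w := Sum.elim (fun i => e' (d i)) w) ?_ ?_
    · convert h1.reindex (Equiv.sumAssoc _ _ _).symm using 1
      funext i
      rcases i with i | i | i <;> simp
    · convert hw.reindex (Equiv.sumAssoc _ _ _).symm using 1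
      funext i
      rcases i with i | i | i <;> rfl
  qfDcl_eq := by
    set S : Set P := (Substructure.closure L (Set.range (Sum.elim (fun i => e (a i)) d)) : Set P) ∪
      {e (b 0)}
    have h0 : Sum.elim (fun i => e (b i)) d (Equiv.natSumNatEquivNat.symm 0) = e (b 0) := by
      rw [show Equiv.natSumNatEquivNat.symm 0 = Sum.inl 0 from
        (Equiv.symm_apply_eq _).2 (by simp)]
      rfl
    rw [h0]
    have h1 : Set.range (Sum.elim (fun i => e (b i)) d) ⊆ qfDcl L S := by
      rintro _ ⟨i | i, rfl⟩
      · exact hd i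
      · exact subset_qfDcl S (Or.inl (Substructure.subset_closure ⟨Sum.inr i, rfl⟩))
    refine Set.univ_subset_iff.1 (subset_trans ?_ (qfDcl_subset_qfDcl h1))
    refine subset_trans ?_ (closure_subset_qfDcl _)
    rw [hP.closure_eq_top]
    exact fun _ _ => Substructure.mem_top _

end IsRCPPair

end AlgVariety

/-! ### Strong embeddings and equality of types. -/

namespace StrongClass

variable {L : FirstOrder.Language.{0, 0}} {K : StrongClass.{u} L} {M N P : Type u}
  [L.Structure M] [L.Structure N] [L.Structure P]

theorem IsAEC.strong_comp (hK : K.IsAEC) {f : M ↪[L] N} {g : N ↪[L] P}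
    (hf : K.IsStrongEmbedding f) (hg : K.IsStrongEmbedding g) :
    K.IsStrongEmbedding (g.comp f) := by
  refine hK.trans _ g.toHom.range ⟨?_, ?_⟩ hg
  · rintro _ ⟨m, rfl⟩
    exact ⟨f m, rfl⟩
  · convert hK.strong_equiv g.equivRange _ hf using 1
    ext ⟨_, m, rfl⟩
    constructor
    · rintro ⟨y, hy⟩
      exact ⟨f y, ⟨y, rfl⟩, Subtype.ext hy⟩
    · rintro ⟨_, ⟨y, rfl⟩, hy⟩
      exact ⟨y, congrArg Subtype.val hy⟩

theorem IsAEC.strong_equiv_comp (hK : K.IsAEC) {f : M ↪[L] N} (hf : K.IsStrongEmbedding f)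
    (φ : N ≃[L] P) : K.IsStrongEmbedding (φ.toEmbedding.comp f) := by
  have hr : (φ.toEmbedding.comp f).toHom.range = f.toHom.range.map φ.toHom := ?_
  · rw [IsStrongEmbedding, hr]
    exact hK.strong_equiv φ _ hf
  ext m
  constructor
  · rintro ⟨y, rfl⟩
    exact ⟨f y, ⟨y, rfl⟩, rfl⟩
  · rintro ⟨_, ⟨y, rfl⟩, rfl⟩
    exact ⟨y, rfl⟩

theorem IsCovering.isStrongEmbedding {V : AlgVariety L} (hK : K.IsCovering V) {f : M ↪[L] N}
    (hM : K.Mem M) (hN : K.Mem N) (hf : V.FreeFactor f.toHom.range) : K.IsStrongEmbedding f :=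
  hK.strong_of_freeFactor N _ (hK.isAEC.mem_equiv f.equivRange hM) hN hf

/-- Transitivity is where amalgamation enters: the two amalgams are amalgamated over the middle
extension. -/
theorem sameGaloisType_equivalence (hap : K.AP) (hK : K.IsAEC) :
    Equivalence (K.SameGaloisType (A := M)) where
  refl p := by
    let := p.str
    have h : K.IsStrongEmbedding (Embedding.refl L p.N) := by
      unfold IsStrongEmbedding
      rw [Embedding.refl_toHom, Hom.range_id]
      exact hK.refl p.mem
    exact ⟨p.N, p.str, Embedding.refl L p.N, Embedding.refl L p.N, p.mem, h, h, fun _ => rfl, rfl⟩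
  symm := by
    rintro p q ⟨P, _, g, h, hP, hg, hh, h1, h2⟩
    exact ⟨P, _, h, g, hP, hh, hg, fun x => (h1 x).symm, h2.symm⟩
  trans := by
    rintro p q r ⟨P, _, g, h, hP, hg, hh, h1, h2⟩ ⟨P', _, g', h', hP', hg', hh', h1', h2'⟩
    let := p.str
    let := q.str
    let := r.str
    obtain ⟨Q, _, k, k', hQ, hk, hk', hkk⟩ := hap q.N P P' q.mem hP hP' h g' hh hg'
    refine ⟨Q, _, k.comp g, k'.comp h', hQ, hK.strong_comp hg hk, hK.strong_comp hh' hk', ?_, ?_⟩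
    · intro x
      simp only [Embedding.comp_apply]
      rw [h1, hkk, h1']
    · simp only [Embedding.comp_apply]
      rw [h2, hkk, h2']

theorem sameOrbit_equivalence (A : L.Substructure M) : Equivalence (SameOrbit A) where
  refl a := ⟨Language.Equiv.refl L M, fun x _ => by simp, by simp⟩
  symm := by
    rintro a b ⟨π, h, rfl⟩
    exact ⟨π.symm, fun x hx => by conv_lhs => rw [← h x hx, π.symm_apply_apply], by simp⟩
  trans := by
    rintro a b c ⟨π, h, rfl⟩ ⟨π', h', rfl⟩
    exact ⟨π'.comp π, fun x hx => by simp [h x hx, h' x hx], by simp⟩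

end StrongClass

/-! ### RCP pairs inside a covering. -/

namespace AlgVariety

variable {L : FirstOrder.Language.{0, 0}} {V : AlgVariety L} {K : StrongClass.{u} L}
  {B F M N N' P : Type u} [L.Structure B] [L.Structure F] [L.Structure M] [L.Structure N]
  [L.Structure N'] [L.Structure P] [L.IsAlgebraic]

namespace IsRCPPair

variable {A : L.Substructure B} {a : ℕ → A} {b : ℕ → B}

/-- If `A ≤ B` is an RCP pair and `D` is free of infinite rank, then `A ∗ D ≼ B ∗ D` in every
covering. -/
theorem strong_closure (h : V.IsRCPPair A a b) (hK : K.IsCovering V) {κ : Type*} [Infinite κ]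
    {e : B →[L] N} {d : κ → N} (hN : V.FreelyGenerates (Sum.elim (fun i => e (b i)) d)) :
    K.Strong (Substructure.closure L (Set.range (Sum.elim (fun i => e (a i)) d))) := by
  have hV := h.isNontrivial
  let z (n : ℕ) : Set.Iic n ⊕ κ → N := Sum.elim (fun i => e (a i)) d
  -- Each stage `⟨a 0, …, a n⟩ ∗ D` is a free factor, and it lies in the class because `D` has
  -- infinite rank.
  have hz (n : ℕ) : K.Strong (Substructure.closure L (Set.range (z n))) := by
    obtain ⟨κ', w, hw⟩ := h.exists_extension_of_sum hN n
    refine hK.strong_of_freeFactor N _ (hK.mem_of_isFreeInf _ ?_) (hK.mem_of_isFreeInf _ ?_) ?_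
    · refine (Indep.freelyGenerates_closure hV ?_ (hN.mem.substructure _)).isFreeInf
      convert (h.indep_sum hN).comp_injective (Sum.map Subtype.val id)
        (Sum.map_injective.2 ⟨Subtype.val_injective, Function.injective_id⟩) using 1
      funext i
      rcases i with i | i <;> rfl
    · exact hN.isFreeInf
    · refine hw.freeFactor_closure_of_subset hV ?_
      rintro _ ⟨i | i, rfl⟩
      · exact ⟨Sum.inl (Sum.inl i), rfl⟩
      · exact ⟨Sum.inr i, rfl⟩
  have hmono {n m : ℕ} (hnm : n ≤ m) : Substructure.closure L (Set.range (z n)) ≤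
      Substructure.closure L (Set.range (z m)) := by
    refine Substructure.closure_mono ?_
    rintro _ ⟨i | i, rfl⟩
    · exact ⟨Sum.inl ⟨i, i.2.trans hnm⟩, rfl⟩
    · exact ⟨Sum.inr i, rfl⟩
  -- Coherence makes the stages a chain under `≼`; smoothness makes their union strong. No index is
  -- a limit, so continuity is vacuous.
  have hchain := (hK.isAEC.chain (ι := ULift.{u} ℕ)
    (fun n => Substructure.closure L (Set.range (z n.down)))
    (fun i j hij => hK.isAEC.coherence _ _ (hz _) (hz _) (hmono hij)) ?_).2.2 fun i => hz _
  · convert hchain using 1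
    rw [← Substructure.closure_iUnion]
    congr 1
    ext m
    simp only [Set.mem_iUnion]
    constructor
    · rintro ⟨i | i, rfl⟩
      · exact ⟨⟨i⟩, Sum.inl ⟨i, le_refl i⟩, rfl⟩
      · exact ⟨⟨0⟩, Sum.inr i, rfl⟩
    · rintro ⟨n, i | i, rfl⟩
      · exact ⟨Sum.inl i, rfl⟩
      · exact ⟨Sum.inr i, rfl⟩
  · rintro ⟨n⟩ hi
    exfalso
    rcases n with _ | n
    · exact hi.1 fun _ _ => Nat.zero_le _
    · refine hi.2 ⟨n⟩ ⟨Nat.lt_succ_self n, ?_⟩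
      intro m hm hm'
      have h1 : n < m.down := hm
      have h2 : m.down < n + 1 := hm'
      omega

/-- A strongly embedded copy of `B` is the quantifier-free definable closure of `A b₀`. -/
theorem range_eq_qfDcl (h : V.IsRCPPair A a b) (hK : K.IsStrongEnough V) (f : B ↪[L] M)
    (hf : K.IsStrongEmbedding f) :
    Set.range f = qfDcl L ((f '' (A : Set B)) ∪ {f (b 0)}) := by
  have h1 := h.map_equiv f.equivRange
  have h2 := hK.qfDcl_eq M _ _ _ _ h1 hf
  rw [h1.qfDcl_eq, Set.image_univ, Subtype.range_coe] at h2
  convert h2 using 3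
  · rw [Hom.range_coe]
    rfl
  · ext m
    constructor
    · rintro ⟨x, hx, rfl⟩
      exact ⟨_, ⟨x, hx, rfl⟩, rfl⟩
    · rintro ⟨_, ⟨x, hx, rfl⟩, rfl⟩
      exact ⟨x, hx, rfl⟩
  · rfl

/-- The RCP pair `A ∗ D ≤ B ∗ D` with `D` free of countable rank. -/
theorem exists_extend (h : V.IsRCPPair A a b) (hK : K.IsCovering V) (hK' : K.IsStrongEnough V) :
    ∃ (P : Type u) (_ : L.Structure P) (e : B ↪[L] P) (d : ℕ → P)
      (a' : ℕ → Substructure.closure L (Set.range (Sum.elim (fun i => e (a i)) d))) (b' : ℕ → P),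
      V.FreelyGenerates (Sum.elim (fun i => e (b i)) d) ∧ b' 0 = e (b 0) ∧
      V.IsRCPPair (Substructure.closure L (Set.range (Sum.elim (fun i => e (a i)) d))) a' b' := by
  have hV := h.isNontrivial
  obtain ⟨P, _, y, hy⟩ := exists_freelyGenerates hV (ULift.{u} (ℕ ⊕ ℕ))
  obtain ⟨e, he, hff⟩ := h.free_right.exists_embedding hV hy
    (σ := fun i => ULift.up (Sum.inl i)) (fun i j hij => by simpa using hij)
  have hP : V.FreelyGenerates (Sum.elim (fun i => e (b i)) (fun i => y ⟨Sum.inr i⟩)) := by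
    convert hy.reindex Equiv.ulift.symm using 1
    funext i
    rcases i with i | i
    · exact he i
    · rfl
  have hstr : K.IsStrongEmbedding e := hK.isStrongEmbedding
    (hK.mem_of_isFreeInf _ h.free_right.isFreeInf) (hK.mem_of_isFreeInf _ hP.isFreeInf) hff
  refine ⟨P, _, e, _, _, _, hP, ?_, h.extend hP fun i => ?_⟩
  · rw [show Equiv.natSumNatEquivNat.symm 0 = Sum.inl 0 from
      (Equiv.symm_apply_eq _).2 (by simp)]
    rfl
  -- `B ≼ P` as a free factor, so the closure of `A b₀` computed in `P` is still all of `B`;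
  -- enlarging `A` to `A ∗ D` only helps.
  · have h1 : e (b i) ∈ Set.range e := ⟨_, rfl⟩
    rw [h.range_eq_qfDcl hK' e hstr] at h1
    refine qfDcl_mono (Set.union_subset_union_left _ ?_) h1
    have h2 := Substructure.closure_mono (L := L) (s := Set.range fun i => e (a i))
      (t := Set.range (Sum.elim (fun i => e (a i)) fun i => y ⟨Sum.inr i⟩)) (by
        rintro _ ⟨i, rfl⟩
        exact ⟨Sum.inl i, rfl⟩)
    have h3 := h.map_eq_closure e.toHom
    rw [Embedding.coe_toHom] at h3
    rw [← h3] at h2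
    exact h2

end IsRCPPair

end AlgVariety

/-! ### Types along a sequence of generators, and their separation. -/

namespace AlgVariety

variable {L : FirstOrder.Language.{0, 0}} {V : AlgVariety L} {K : StrongClass.{u} L}
  {B F M N N' P : Type u} [L.Structure B] [L.Structure F] [L.Structure M] [L.Structure N]
  [L.Structure N'] [L.Structure P]

theorem FreelyGenerates.mk_le [Countable L.Symbols] {ι : Type u} {x : ι → M}
    (hx : V.FreelyGenerates x) : #M ≤ max ℵ₀ #ι := by
  have hsurj : Function.Surjective (fun t : L.Term ι => t.realize x) := fun m =>
    exists_term_of_mem_closure (hx.closure_eq_top ▸ Substructure.mem_top m)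
  refine (mk_le_of_surjective hsurj).trans (Term.card_le.trans ?_)
  simp only [mk_sum, lift_id']
  refine max_le (le_max_left _ _) ((add_le_max _ _).trans ?_)
  have : Cardinal.lift.{u} #(Σ i, L.Functions i) ≤ ℵ₀ := by
    rw [lift_le_aleph0]
    exact mk_le_aleph0
  exact max_le (max_le (le_max_right _ _) (this.trans (le_max_left _ _))) (le_max_left _ _)

variable [L.IsAlgebraic]

namespace IsRCPPair

variable {A : L.Substructure B} {a : ℕ → A} {b : ℕ → B} {T : Type u} {x : T → F} {p p' : ℕ → T}

/-- The generators of a free algebra `F` along a sequence `p` can be identified with the generators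
`a` of `A`, and `F` is a strong submodel of the resulting free product of `B` with a free
algebra. -/
theorem exists_strong_extension [Countable L.Symbols] (h : V.IsRCPPair A a b)
    (hK : K.IsCovering V) (hx : V.FreelyGenerates x) (hp : Function.Injective p)
    (hp' : (Set.range p)ᶜ.Infinite) :
    ∃ (N : Type u) (_ : L.Structure N) (e : B ↪[L] N) (i : F ↪[L] N), K.Mem N ∧ #N ≤ #T ∧
      K.IsStrongEmbedding i ∧ (∀ k, i (x (p k)) = e (a k)) ∧
      V.FreelyGenerates (Sum.elim (fun k => e (b k)) (fun t : ↥(Set.range p)ᶜ => i (x t))) := by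
  have hV := h.isNontrivial
  have : Infinite ↥(Set.range p)ᶜ := hp'.to_subtype
  have : Infinite T := Infinite.of_injective p hp
  obtain ⟨N, _, y, hy⟩ := exists_freelyGenerates hV (ULift.{u} ℕ ⊕ ↥(Set.range p)ᶜ)
  obtain ⟨e, he, -⟩ := h.free_right.exists_embedding hV hy
    (σ := fun i => Sum.inl (ULift.up i)) (fun i j hij => by simpa using hij)
  have hN : V.FreelyGenerates (Sum.elim (fun k => e (b k)) (fun t => y (Sum.inr t))) := by
    convert hy.reindex (Equiv.sumCongr Equiv.ulift.symm (Equiv.refl _)) using 1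
    funext i
    rcases i with i | i
    · exact he i
    · rfl
  classical
  let σ : ℕ ⊕ ↥(Set.range p)ᶜ ≃ T :=
    (Equiv.sumCongr (Equiv.ofInjective p hp) (Equiv.refl _)).trans
      (Equiv.Set.sumCompl (Set.range p))
  -- Generators along `p` go to `a`, the others to fresh generators; `indep_sum` makes this an
  -- embedding, with image `A ∗ D`.
  obtain ⟨i, hi, hr⟩ := (hx.reindex σ).exists_embedding_of_indep hV hN.mem
    (h.indep_sum (e := e.toHom) hN)
  have hi1 (k : ℕ) : i (x (p k)) = e (a k) := by
    simpa [σ] using hi (Sum.inl k)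
  have hi2 (t : ↥(Set.range p)ᶜ) : i (x t) = y (Sum.inr t) := by
    simpa [σ] using hi (Sum.inr t)
  refine ⟨N, _, e, i, hK.mem_of_isFreeInf _ hN.isFreeInf, ?_, ?_, hi1, ?_⟩
  · refine hy.mk_le.trans (max_le (aleph0_le_mk T) ?_)
    rw [← (Equiv.sumCongr Equiv.ulift (Equiv.refl _)).trans σ |>.cardinal_eq]
  · unfold StrongClass.IsStrongEmbedding
    rw [hr]
    exact h.strong_closure hK hN
  · simpa only [hi2] using hN

/-- The types of `b₀` along two sequences which branch differ. -/
theorem point_ne_of_branch (h : V.IsRCPPair A a b) (hK : K.IsCovering V)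
    (hK' : K.IsStrongEnough V) (hp : Function.Injective p) (hp' : Function.Injective p')
    {n : ℕ} (heq : ∀ k ≤ n, p k = p' k) (hne : ∀ k, n < k → p k ∉ Set.range p')
    (hne' : ∀ k, n < k → p' k ∉ Set.range p)
    {e : B ↪[L] N} {i : F ↪[L] N} (hi : ∀ k, i (x (p k)) = e (a k))
    (hN : V.FreelyGenerates (Sum.elim (fun k => e (b k)) (fun t : ↥(Set.range p)ᶜ => i (x t))))
    {e' : B ↪[L] N'} {i' : F ↪[L] N'} (hi' : ∀ k, i' (x (p' k)) = e' (a k))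
    (hN' : V.FreelyGenerates
      (Sum.elim (fun k => e' (b k)) (fun t : ↥(Set.range p')ᶜ => i' (x t))))
    {g : N ↪[L] M} {g' : N' ↪[L] M} (hg : K.IsStrongEmbedding g) (hg' : K.IsStrongEmbedding g')
    (hgi : ∀ m, g (i m) = g' (i' m)) : g (e (b 0)) ≠ g' (e' (b 0)) := by
  intro hpt
  have hV := h.isNontrivial
  obtain ⟨P, _, c, d, a', b', hP, hb', hAP⟩ := h.exists_extend hK hK'
  -- Beyond level `n` the other sequence `q` avoids `p`, so its nodes belong to the basis of `N` and
  -- can carry `D`.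
  have embed {p q : ℕ → T} (hq : Function.Injective q) (hne : ∀ k, n < k → q k ∉ Set.range p)
      {N : Type u} [L.Structure N] {e : B ↪[L] N} {i : F ↪[L] N}
      (hN : V.FreelyGenerates
        (Sum.elim (fun k => e (b k)) (fun t : ↥(Set.range p)ᶜ => i (x t)))) :
      ∃ j : P ↪[L] N, (∀ m, j (c m) = e m) ∧ (∀ k, j (d k) = i (x (q (n + 1 + k)))) ∧
        K.IsStrongEmbedding j := by
    obtain ⟨j, hj, hff⟩ := hP.exists_embedding hV hN
      (σ := Sum.map id fun k => ⟨q (n + 1 + k), hne _ (by omega)⟩)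
      (Sum.map_injective.2 ⟨Function.injective_id, fun k l hkl => by
        simpa using hq (congrArg Subtype.val hkl)⟩)
    refine ⟨j, fun m => ?_, fun k => hj (Sum.inr k), hK.isStrongEmbedding
      (hK.mem_of_isFreeInf _ hP.isFreeInf) (hK.mem_of_isFreeInf _ hN.isFreeInf) hff⟩
    have : j.toHom.comp c.toHom = e.toHom :=
      h.free_right.hom_ext hN.mem fun k => hj (Sum.inl k)
    exact DFunLike.congr_fun this m
  obtain ⟨j, hj1, hj2, hj⟩ := embed hp' hne' hN
  obtain ⟨j', hj1', hj2', hj'⟩ := embed hp hne hN'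
  let G := g.comp j
  let G' := g'.comp j'
  have hG : K.IsStrongEmbedding G := hK.isAEC.strong_comp hj hg
  have hG' : K.IsStrongEmbedding G' := hK.isAEC.strong_comp hj' hg'
  have G1 (k : ℕ) : G (c (a k)) = g (i (x (p k))) := by simp [G, hj1, hi]
  have G2 (k : ℕ) : G (d k) = g (i (x (p' (n + 1 + k)))) := by simp [G, hj2]
  have G1' (k : ℕ) : G' (c (a k)) = g (i (x (p' k))) := by simp [G', hj1', hgi, hi']
  have G2' (k : ℕ) : G' (d k) = g (i (x (p (n + 1 + k)))) := by simp [G', hj2', hgi]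
  have hset : ∀ (H : P ↪[L] M) (S : Set P), H '' (Substructure.closure L S : Set P) =
      Substructure.closure L (H '' S) := fun H S => by
    have := Substructure.map_closure H.toHom S
    rw [Embedding.coe_toHom] at this
    rw [← this]
    rfl
  -- Each tail carries the late `a k` in one copy of `P` and `d` in the other, so the two generating
  -- sets of `A ∗ D` agree.
  have key : G '' Set.range (Sum.elim (fun k => c (a k)) d) =
      G' '' Set.range (Sum.elim (fun k => c (a k)) d) := by
    rw [← Set.range_comp, ← Set.range_comp]
    refine subset_antisymm ?_ ?_
    · rintro _ ⟨k | k, rfl⟩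
      · by_cases hk : k ≤ n
        · exact ⟨Sum.inl k, by simp [G1, G1', heq k hk]⟩
        · exact ⟨Sum.inr (k - (n + 1)), by simp [G1, G2', Nat.add_sub_cancel' (not_le.1 hk)]⟩
      · exact ⟨Sum.inl (n + 1 + k), by simp [G2, G1']⟩
    · rintro _ ⟨k | k, rfl⟩
      · by_cases hk : k ≤ n
        · exact ⟨Sum.inl k, by simp [G1, G1', heq k hk]⟩
        · exact ⟨Sum.inr (k - (n + 1)), by simp [G1', G2, Nat.add_sub_cancel' (not_le.1 hk)]⟩
      · exact ⟨Sum.inl (n + 1 + k), by simp [G2', G1]⟩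
  have hpt' : G (b' 0) = G' (b' 0) := by simp [G, G', hb', hj1, hj1', hpt]
  have hrange : Set.range G = Set.range G' := by
    rw [hAP.range_eq_qfDcl hK' G hG, hAP.range_eq_qfDcl hK' G' hG', hset, hset, key, hpt']
  have hsub : ∀ m, ∃ m', G' m' = G m := fun m => by
    have : G m ∈ Set.range G' := hrange ▸ ⟨m, rfl⟩
    exact this
  have hrange' : G'.toHom.range = G.toHom.range := SetLike.coe_injective (by
    simpa only [Hom.range_coe, Embedding.coe_toHom] using hrange.symm)
  -- Since `G` and `G'` have the same range, `α` is `G⁻¹ ∘ G'`.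
  obtain ⟨α, hα⟩ : ∃ α : P ≃[L] P, ∀ m, G (α m) = G' m := by
    let f : P →[L] P := G.equivRange.symm.toHom.comp
      (G'.toHom.codRestrict G.toHom.range fun m => hrange' ▸ ⟨m, rfl⟩)
    have hf : ∀ m, G (f m) = G' m := fun m => by
      have := congrArg Subtype.val (G.equivRange.apply_symm_apply
        (G'.toHom.codRestrict G.toHom.range (fun m => hrange' ▸ ⟨m, rfl⟩) m))
      rw [Embedding.equivRange_apply] at this
      exact this
    have hbij : Function.Bijective f := by
      constructor
      · intro m m' hmm
        exact G'.injective (by rw [← hf, ← hf, hmm])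
      · intro m
        obtain ⟨m', hm'⟩ := hsub m
        exact ⟨m', G.injective (by rw [hf, hm'])⟩
    exact ⟨⟨Equiv.ofBijective f hbij, fun s z => f.map_fun s z, fun r => isEmptyElim r⟩, hf⟩
  obtain ⟨κ', w, hw⟩ := h.exists_extension_of_sum (e := c.toHom) hP n
  have hα1 (k : Set.Iic n) : α (c (a k)) = c (a k) :=
    G.injective (by rw [hα, G1', G1, heq k k.2])
  have hα2 (l : ℕ) : α (c (a (n + 1 + l))) = d l := G.injective (by rw [hα, G1', G2])
  -- In the basis `a 0, …, a n, w, d`, the element `d l` is renamed as the image under `α` of `a (n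
  -- + 1 + l)`.
  let τ : (Set.Iic n ⊕ κ') ⊕ ℕ → ℕ ⊕ κ' :=
    Sum.elim (Sum.map Subtype.val id) (fun l => Sum.inl (n + 1 + l))
  have hτ : Function.Bijective τ := by
    constructor
    · rintro ((⟨k, hk⟩ | k) | k) ((⟨l, hl⟩ | l) | l) hkl <;>
        (try rw [Set.mem_Iic] at hk) <;> (try rw [Set.mem_Iic] at hl) <;>
        simp [τ] at hkl ⊢ <;> omega
    · rintro (k | k)
      · by_cases hk : k ≤ n
        · exact ⟨Sum.inl (Sum.inl ⟨k, hk⟩), rfl⟩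
        · exact ⟨Sum.inr (k - (n + 1)), congrArg Sum.inl (Nat.add_sub_cancel' (not_le.1 hk))⟩
      · exact ⟨Sum.inl (Sum.inr k), rfl⟩
  have hbasis : V.FreelyGenerates (Sum.elim (fun k => α (c (a k))) w) := by
    convert hw.reindex (Equiv.ofBijective τ hτ).symm using 1
    rw [Equiv.eq_comp_symm]
    funext m
    rcases m with (m | m) | m
    · exact hα1 m
    · rfl
    · exact hα2 m
  refine h.not_freelyGenerates (e := c) hP (w := fun m => α.symm (w m)) ?_
  convert hbasis.map_equiv α.symm using 1
  funext m
  rcases m with m | m <;> simp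

end IsRCPPair

end AlgVariety

/-! ### The tree of finite sequences, and the choice of cardinal. -/

/-- The first `k` values of a sequence. -/
def initialSegment {Λ : Type*} (η : ℕ → Λ) (k : ℕ) : List Λ := (List.range k).map η

theorem initialSegment_eq_iff {Λ : Type*} {η ν : ℕ → Λ} {k l : ℕ} :
    initialSegment η k = initialSegment ν l ↔ k = l ∧ ∀ i < k, η i = ν i := by
  constructor
  · intro h
    have hkl : k = l := by simpa [initialSegment] using congrArg List.length h
    subst hkl
    exact ⟨rfl, fun i hi => List.map_inj_left.1 h i (List.mem_range.2 hi)⟩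
  · rintro ⟨rfl, h⟩
    exact List.map_inj_left.2 fun i hi => h i (List.mem_range.1 hi)

theorem initialSegment_injective {Λ : Type*} (η : ℕ → Λ) :
    Function.Injective (initialSegment η) := fun _ _ h => (initialSegment_eq_iff.1 h).1

theorem initialSegment_notMem_range {Λ : Type*} {η ν : ℕ → Λ} {n k : ℕ} (h : η n ≠ ν n)
    (hk : n < k) : initialSegment η k ∉ Set.range (initialSegment ν) := by
  rintro ⟨l, hl⟩
  obtain ⟨rfl, hi⟩ := initialSegment_eq_iff.1 hl
  exact h (hi n hk).symm

/-- Guarantees that `D` has infinite rank. The witnesses are nonempty segments of a constant branch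
leaving `η` at once; the empty segment lies on every branch. -/
theorem infinite_compl_range_initialSegment {Λ : Type*} [Nontrivial Λ] (η : ℕ → Λ) :
    (Set.range (initialSegment η))ᶜ.Infinite := by
  obtain ⟨y, hy⟩ := exists_ne (η 0)
  refine Set.infinite_of_injective_forall_mem (f := fun k => initialSegment (fun _ => y) (k + 1))
    (fun k l h => ?_) fun k => initialSegment_notMem_range hy k.succ_pos
  simpa using initialSegment_injective _ h

theorem exists_branching {Λ : Type*} {η ν : ℕ → Λ} (h : η ≠ ν) : ∃ n,
    (∀ k ≤ n, initialSegment η k = initialSegment ν k) ∧ η n ≠ ν n := by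
  classical
  have h' : ∃ n, η n ≠ ν n := Function.ne_iff.1 h
  refine ⟨Nat.find h', fun k hk => initialSegment_eq_iff.2 ⟨rfl, fun i hi => ?_⟩, Nat.find_spec h'⟩
  exact not_not.1 (Nat.find_min h' (hi.trans_le hk))

/-- The index `μ.ord + ω` gives an aleph of cofinality ω, to which König's theorem applies. -/
theorem exists_lt_power_aleph0 (μ : Cardinal.{u}) :
    ∃ lam : Cardinal.{u}, μ ≤ lam ∧ ℵ₀ ≤ lam ∧ lam < lam ^ ℵ₀ := by
  refine ⟨ℵ_ (μ.ord + Ordinal.omega0), ?_, aleph0_le_aleph _, ?_⟩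
  · calc μ = μ.ord.card := (card_ord μ).symm
      _ ≤ (Ordinal.omega μ.ord).card :=
        Ordinal.card_le_card (Ordinal.isNormal_omega.strictMono.le_apply)
      _ = ℵ_ μ.ord := Ordinal.card_omega _
      _ ≤ ℵ_ (μ.ord + Ordinal.omega0) := aleph_le_aleph.2 (by simp)
  · have h := lt_power_cof_ord (aleph0_le_aleph (μ.ord + Ordinal.omega0))
    rwa [ord_aleph, Ordinal.cof_omega (Ordinal.isSuccLimit_add _ Ordinal.isSuccLimit_omega0),
      Ordinal.cof_add _ Ordinal.omega0_ne_zero, Ordinal.cof_omega0] at h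

/-! ### Many types over one model, and their realization in monster models. -/

namespace AlgVariety

variable {L : FirstOrder.Language.{0, 0}} [L.IsAlgebraic] [Countable L.Symbols] {V : AlgVariety L}
  {K : StrongClass.{u} L}

/-- Over some model of size `lam` there are `lam ^ ℵ₀` types. -/
theorem exists_model_pointed_extensions (hV : AlgVariety.RCP.{u} V) (hK : K.IsCovering V)
    (hK' : K.IsStrongEnough V) {lam : Cardinal.{u}} (hlam : ℵ₀ ≤ lam) (hlam' : lam < lam ^ ℵ₀) :
    ∃ (F : Type u) (_ : L.Structure F) (I : Type u) (q : I → K.PointedExt F), K.Mem F ∧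
      #F = lam ∧ lam < #I ∧ (∀ i, #(q i).N ≤ lam) ∧ ∀ i j, K.SameGaloisType (q i) (q j) → i = j := by
  obtain ⟨B, _, A, a, b, h⟩ := hV
  -- There are `lam` nodes in `List Λ` but `lam ^ ℵ₀` branches `ℕ → Λ`.
  let Λ := lam.out
  have : Infinite Λ := infinite_iff.2 (by rwa [mk_out])
  have hT : #(List Λ) = lam := by rw [mk_list_eq_mk, mk_out]
  obtain ⟨F, _, x, hx⟩ := exists_freelyGenerates h.isNontrivial (List Λ)
  have key := fun η : ℕ → Λ => h.exists_strong_extension hK hx (initialSegment_injective η)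
    (infinite_compl_range_initialSegment η)
  choose N strN e i hN hcard hi hie hb using key
  refine ⟨F, _, ℕ → Λ, fun η => ⟨N η, strN η, hN η, i η, hi η, e η (b 0)⟩,
    hK.mem_of_isFreeInf _ hx.isFreeInf, ?_, ?_, fun η => hT ▸ hcard η, ?_⟩
  · refine le_antisymm (hx.mk_le.trans ?_) (hT ▸ mk_le_of_injective hx.injective)
    rw [hT]
    exact max_le hlam le_rfl
  · simpa [Λ] using hlam'
  · rintro η ν ⟨P, _, g, g', -, hg, hg', h1, h2⟩
    by_contra hne
    obtain ⟨n, hn, hn'⟩ := exists_branching hne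
    exact h.point_ne_of_branch hK hK' (initialSegment_injective η) (initialSegment_injective ν)
      hn (fun k => initialSegment_notMem_range hn') (fun k => initialSegment_notMem_range hn'.symm)
      (hie η) (hb η) (hie ν) (hb ν) hg hg' h1 h2

end AlgVariety

namespace StrongClass

variable {L : FirstOrder.Language.{0, 0}} {K : StrongClass.{u} L}

/-- A strong extension of a small strong submodel of a monster model embeds over it. -/
theorem IsMonster.exists_embedding (hK : K.IsAEC) {κ : Cardinal.{u}} {F M N : Type u}
    [L.Structure F] [L.Structure M] [L.Structure N] (hM : K.IsMonster κ M) {f : F ↪[L] M}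
    (hf : K.IsStrongEmbedding f) (hF : #F < κ) {i : F ↪[L] N} (hi : K.IsStrongEmbedding i)
    (hN : K.Mem N) (hNκ : #N ≤ κ) :
    ∃ g : N ↪[L] M, K.IsStrongEmbedding g ∧ ∀ x, g (i x) = f x := by
  obtain ⟨u, hu⟩ := hM.universal N hN hNκ
  have card_range (f : F ↪[L] M) : #f.toHom.range < κ := by
    rwa [← f.equivRange.toEquiv.cardinal_eq]
  -- Universality places `N` somewhere in `M`; homogeneity then moves its copy of `F` onto the
  -- prescribed one.
  obtain ⟨π, hπ⟩ := hM.homogeneous _ _ (hK.strong_comp hi hu) hf (card_range _) (card_range _)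
    (f.equivRange.comp (u.comp i).equivRange.symm)
  refine ⟨π.toEmbedding.comp u, hK.strong_equiv_comp hu π, fun x => ?_⟩
  have := hπ ((u.comp i).equivRange x)
  rwa [Language.Equiv.comp_apply, Language.Equiv.symm_apply_apply, Embedding.equivRange_apply,
    Embedding.equivRange_apply] at this

end StrongClass

end

theorem theorem1p5 (L : FirstOrder.Language.{0, 0}) [L.IsAlgebraic] [Countable L.Symbols]
    (V : AlgVariety L) (hV : AlgVariety.RCP.{u} V)
    (K : StrongClass.{u} L) (hcov : K.IsCovering V) (hstrong : K.IsStrongEnough V) :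
    ¬ K.Superstable ∧ ¬ K.MonsterSuperstable := by
  constructor
  · rintro ⟨μ, h⟩
    obtain ⟨lam, hμ, h0, hlam⟩ := exists_lt_power_aleph0 μ
    obtain ⟨F, _, I, q, hF, hFc, hI, -, hq⟩ :=
      AlgVariety.exists_model_pointed_extensions hV hcov hstrong h0 hlam
    have hinj : Function.Injective (fun i => (Quot.mk _ (q i) : K.GaloisTypes F)) := by
      intro i j hij
      exact hq i j ((StrongClass.sameGaloisType_equivalence hcov.ap hcov.isAEC).quot_mk_eq_iff
        _ _ |>.1 hij)
    have h1 := (lift_mk_le_lift_mk_of_injective hinj).trans (lift_le.2 (h lam hμ F hF hFc))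
    simp only [lift_lift] at h1
    exact absurd h1 (not_le.2 (by simpa using hI))
  · rintro ⟨μ, h⟩
    obtain ⟨lam, hμ, h0, hlam⟩ := exists_lt_power_aleph0 μ
    obtain ⟨F, _, I, q, hF, hFc, hI, hqc, hq⟩ :=
      AlgVariety.exists_model_pointed_extensions hV hcov hstrong h0 hlam
    obtain ⟨κ, hκ, M, _, hM, hMA⟩ := h lam hμ
    obtain ⟨f, hf⟩ := hM.universal F hF (hFc.trans_le hκ.le)
    have hext (i : I) : letI := (q i).str
        ∃ g : (q i).N ↪[L] M, K.IsStrongEmbedding g ∧ ∀ x, g ((q i).emb x) = f x :=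
      let := (q i).str
      hM.exists_embedding hcov.isAEC hf (hFc.trans_lt hκ) (q i).strong (q i).mem
        ((hqc i).trans hκ.le)
    choose g hg hgf using hext
    have hinj : Function.Injective (fun i => (Quot.mk _ (letI := (q i).str; g i (q i).pt) :
        StrongClass.OrbitTypes f.toHom.range)) := by
      intro i j hij
      obtain ⟨π, hπ, hπ'⟩ := ((StrongClass.sameOrbit_equivalence f.toHom.range).quot_mk_eq_iff
        _ _).1 hij
      let := (q i).str
      let := (q j).str
      -- An automorphism over `F` that matches the two points turns `M` into an amalgam witnessing
      -- equality of Galois types.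
      refine hq i j ⟨M, _, π.toEmbedding.comp (g i), g j, hM.mem,
        hcov.isAEC.strong_equiv_comp (hg i) π, hg j, fun x => ?_, hπ'⟩
      exact ((congrArg π (hgf i x)).trans (hπ _ ⟨x, rfl⟩)).trans (hgf j x).symm
    refine absurd ((mk_le_of_injective hinj).trans (hMA _ hf ?_)) (not_le.2 hI)
    rw [← f.equivRange.toEquiv.cardinal_eq, hFc]
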